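/- Let $\mathbb K=\mathbb R$ or $\mathbb C$ and fix a parity $\varepsilon\in\mathbb Z_2$. **Graded domains.** Let $G=\mathbb Z$ or $G=\mathbb Z^n$. An element $k\in\mathbb Z$ has parity $\bar k\varepsilon$, and $\delta\in\mathbb Z^n$ has parity $\bar\delta_1\varepsilon+\dots+\bar\delta_n\varepsilon$. Given finitely many coordinates, $d_g$ of each weight $g\in G$, and an open set $U\subset\mathbb K^{d_0}$, the $G$-graded domain over $U$ is the ringed space $(U,\mathcal O)$, where $\mathcal O$ is the sheaf associated with $W\mapsto \mathcal F(W)\otimes_{\mathbb K} S^*$; here $\mathcal F$ is the sheaf of smooth (if $\mathbb K=\mathbb R$) or holomorphic (if $\mathbb K=\mathbb C$) functions and $S^*$ is the super-symmetric $\mathbb K$-algebra generated by the coordinates of non-zero weight, the parity of a coordinate being that of its weight. It is graded by the weights of the coordinates. **Graded manifolds.** A $G$-graded manifold is a $G$-graded ringed space over $\mathbb K$ with Hausdorff second countable base which is locally isomorphic to $G$-graded domains with fixed numbers $d_g$. A morphism is a weight-preserving morphism of ringed spaces of $\mathbb K$-algebras that is local on the stalks of the weight-$0$ subsheaves. A graded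 manifold of degree $n$ is a $\mathbb Z$-graded manifold with $d_k=0$ unless $0\le k\le n$. An $n$-fold vector bundle is a $\mathbb Z^n$-graded manifold with $d_\delta=0$ unless $\delta\in\{0,1\}^n$. An $n$-fold vector bundle is also $\mathbb Z$-graded through the total degree $\delta\mapsto\delta_1+\dots+\delta_n$. **Coverings.** A covering of a graded manifold $\mathcal N$ of degree $n$ in the category of $n$-fold vector bundles is an $n$-fold vector bundle $\mathcal Q$ together with a $\mathbb Z$-graded morphism $\mathsf q:\mathcal Q\to\mathcal N$ such that for every $n$-fold vector bundle $\mathcal D$ and every $\mathbb Z$-graded morphism $\phi:\mathcal D\to\mathcal N$ there is a unique morphism $\Phi:\mathcal D\to\mathcal Q$ of $n$-fold vector bundles with $\phi=\mathsf q\circ\Phi$. **Theorem.** (1) Let $\mathcal N$ be a graded manifold of degree $n$ with non-empty base that has coordinates of some weight $k\ge 2$, that is, $d_k\neq0$ for some $2\le k\le n$ (so $n\ge2$). Then $\mathcal N$ has no covering in the category of $n$-fold vector bundles. (2) In particular, already for $n=2$, the graded domain with coordinates $x,\xi^1,\xi^2$ of weights $0,1,2$ over any non-empty open subset of $\mathbb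 K$ has no covering in the category of double vector bundles. -/

import Mathlib

open CategoryTheory TopologicalSpace Opposite AlgebraicGeometry
open scoped ContDiff

noncomputable section

namespace GradedGeometry

/-! ### The super-symmetric algebra -/

section Algebra

variable (𝕜 : Type) [RCLike 𝕜] {κ : Type}

/-- Super-commutation of the generators: `x_i x_j = (-1)^{|i||j|} x_j x_i`. -/
inductive SuperRel (par : κ → ZMod 2) : FreeAlgebra 𝕜 κ → FreeAlgebra 𝕜 κ → Prop
  | comm (i j : κ) : SuperRel par
      (FreeAlgebra.ι 𝕜 i * FreeAlgebra.ι 𝕜 j)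
      ((-1 : 𝕜) ^ (par i * par j).val • (FreeAlgebra.ι 𝕜 j * FreeAlgebra.ι 𝕜 i))

/-- The super-symmetric algebra on generators indexed by `κ`, the `i`-th one of parity `par i`:
polynomial in the even generators, exterior in the odd ones. -/
def SuperSym (par : κ → ZMod 2) : Type := RingQuot (SuperRel 𝕜 par)

instance (par : κ → ZMod 2) : Ring (SuperSym 𝕜 par) :=
  inferInstanceAs (Ring (RingQuot (SuperRel 𝕜 par)))

instance (par : κ → ZMod 2) : Algebra 𝕜 (SuperSym 𝕜 par) :=
  inferInstanceAs (Algebra 𝕜 (RingQuot (SuperRel 𝕜 par)))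

/-- The `i`-th generator of the super-symmetric algebra. -/
def SuperSym.gen (par : κ → ZMod 2) (i : κ) : SuperSym 𝕜 par :=
  RingQuot.mkAlgHom 𝕜 (SuperRel 𝕜 par) (FreeAlgebra.ι 𝕜 i)

/-- The homogeneous elements of weight `w`, the `i`-th generator having weight `wt i`:
the span of the products of generators whose weights add up to `w`. -/
def SuperSym.homogeneous {G : Type} [AddCommGroup G] (par : κ → ZMod 2) (wt : κ → G) (w : G) :
    Submodule 𝕜 (SuperSym 𝕜 par) :=
  Submodule.span 𝕜
    {a | ∃ l : List κ, (l.map wt).sum = w ∧ a = (l.map (SuperSym.gen 𝕜 par)).prod}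

variable {𝕜}

theorem SuperSym.one_mem_homogeneous {G : Type} [AddCommGroup G] (par : κ → ZMod 2)
    (wt : κ → G) : (1 : SuperSym 𝕜 par) ∈ SuperSym.homogeneous 𝕜 par wt 0 :=
  Submodule.subset_span ⟨[], by simp, by simp⟩

theorem SuperSym.mul_mem_homogeneous {G : Type} [AddCommGroup G] (par : κ → ZMod 2)
    (wt : κ → G) {v w : G} {a b : SuperSym 𝕜 par} (ha : a ∈ SuperSym.homogeneous 𝕜 par wt v)
    (hb : b ∈ SuperSym.homogeneous 𝕜 par wt w) :
    a * b ∈ SuperSym.homogeneous 𝕜 par wt (v + w) := by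
  have h : SuperSym.homogeneous 𝕜 par wt v * SuperSym.homogeneous 𝕜 par wt w ≤
      SuperSym.homogeneous 𝕜 par wt (v + w) := by
    rw [SuperSym.homogeneous, SuperSym.homogeneous, Submodule.span_mul_span]
    refine Submodule.span_mono ?_
    rintro _ ⟨_, ⟨l, hl, rfl⟩, _, ⟨m, hm, rfl⟩, rfl⟩
    exact ⟨l ++ m, by simp [hl, hm], by simp⟩
  exact h (Submodule.mul_mem_mul ha hb)

end Algebra

/-! ### Graded ringed spaces -/

/-- A `G`-graded ringed space over `𝕜`: a topological space with a sheaf of (not necessarily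
commutative) `𝕜`-algebras and, for every weight `g : G`, a subsheaf of homogeneous sections of
weight `g`, such that `1` has weight `0` and weights add under multiplication. -/
structure GradedSpace (𝕜 : Type) [RCLike 𝕜] (G : Type) [AddCommGroup G] where
  /-- the underlying ringed space -/
  space : SheafedSpace (AlgCat.{0} 𝕜)
  /-- the homogeneous sections of weight `g` over `W` -/
  weight : ∀ (W : Opens space) (_ : G), Submodule 𝕜 (space.presheaf.obj (op W))
  weight_res : ∀ {V W : Opens space} (i : V ⟶ W) (g : G) (s : space.presheaf.obj (op W)),
    s ∈ weight W g → (space.presheaf.map i.op).hom s ∈ weight V g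
  weight_loc : ∀ (W : Opens space) (g : G) (s : space.presheaf.obj (op W)),
    (∀ x ∈ W, ∃ (V : Opens space) (i : V ⟶ W), x ∈ V ∧
      (space.presheaf.map i.op).hom s ∈ weight V g) → s ∈ weight W g
  one_mem : ∀ W : Opens space, (1 : space.presheaf.obj (op W)) ∈ weight W 0
  mul_mem : ∀ (W : Opens space) (g h : G) (s t : space.presheaf.obj (op W)),
    s ∈ weight W g → t ∈ weight W h → s * t ∈ weight W (g + h)

namespace GradedSpace

variable {𝕜 : Type} [RCLike 𝕜] {G : Type} [AddCommGroup G]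

/-- The section `f` of weight `0` becomes, near the point `x`, a unit of the sheaf of sections of
weight `0`; that is, its germ at `x` is a unit of the stalk of that sheaf. -/
def IsUnitNear (X : GradedSpace 𝕜 G) {W : Opens X.space} (f : X.space.presheaf.obj (op W))
    (x : X.space) : Prop :=
  ∃ (V : Opens X.space) (i : V ⟶ W), x ∈ V ∧
    ∃ g ∈ X.weight V 0, (X.space.presheaf.map i.op).hom f * g = 1

/-- Pull-back of sections over `W` along a morphism of ringed spaces. -/
def pull {X Y : SheafedSpace (AlgCat.{0} 𝕜)} (f : X ⟶ Y) (W : Opens Y) :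
    Y.presheaf.obj (op W) →ₐ[𝕜] X.presheaf.obj (op ((Opens.map f.hom.base).obj W)) :=
  (f.hom.c.app (op W)).hom

theorem res_res (X : SheafedSpace (AlgCat.{0} 𝕜)) {V V' W : Opens X} (j : V' ⟶ V) (i : V ⟶ W)
    (k : V' ⟶ W) (s : X.presheaf.obj (op W)) :
    (X.presheaf.map j.op).hom ((X.presheaf.map i.op).hom s) = (X.presheaf.map k.op).hom s := by
  rw [Subsingleton.elim k (j ≫ i), op_comp, X.presheaf.map_comp]
  rfl

/-- Finite sums of homogeneous sections over `W` of weights `g` with `χ g = h`. -/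
def sumWeight {H : Type} [AddCommGroup H] (χ : G →+ H) (X : GradedSpace 𝕜 G) (W : Opens X.space)
    (h : H) : Submodule 𝕜 (X.space.presheaf.obj (op W)) :=
  ⨆ g : {g : G // χ g = h}, X.weight W g.1

theorem sumWeight_res {H : Type} [AddCommGroup H] (χ : G →+ H) (X : GradedSpace 𝕜 G)
    {V W : Opens X.space} (i : V ⟶ W) (h : H) (s : X.space.presheaf.obj (op W))
    (hs : s ∈ sumWeight χ X W h) : (X.space.presheaf.map i.op).hom s ∈ sumWeight χ X V h := by
  have : sumWeight χ X W h ≤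
      (sumWeight χ X V h).comap (X.space.presheaf.map i.op).hom.toLinearMap := by
    refine iSup_le fun g t ht => ?_
    exact Submodule.mem_iSup_of_mem g (X.weight_res i g.1 t ht)
  exact this hs

theorem sumWeight_mul {H : Type} [AddCommGroup H] (χ : G →+ H) (X : GradedSpace 𝕜 G)
    (W : Opens X.space) (h h' : H) (s t : X.space.presheaf.obj (op W))
    (hs : s ∈ sumWeight χ X W h) (ht : t ∈ sumWeight χ X W h') :
    s * t ∈ sumWeight χ X W (h + h') := by
  have : sumWeight χ X W h * sumWeight χ X W h' ≤ sumWeight χ X W (h + h') := by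
    rw [sumWeight, sumWeight, Submodule.iSup_mul]
    refine iSup_le fun g => ?_
    rw [Submodule.mul_iSup]
    refine iSup_le fun g' => Submodule.mul_le.2 fun a ha b hb => ?_
    exact Submodule.mem_iSup_of_mem ⟨g.1 + g'.1, by rw [map_add, g.2, g'.2]⟩
      (X.mul_mem W g.1 g'.1 a b ha hb)
  exact this (Submodule.mul_mem_mul hs ht)

/-- The `H`-grading induced by a homomorphism `χ : G → H`: sections of weight `h` are locally
finite sums of homogeneous sections of weights `g` with `χ g = h`. -/
def collapse {H : Type} [AddCommGroup H] (χ : G →+ H) (X : GradedSpace 𝕜 G) :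
    GradedSpace 𝕜 H where
  space := X.space
  weight W h :=
    { carrier := {s | ∀ x ∈ W, ∃ (V : Opens X.space) (i : V ⟶ W), x ∈ V ∧
        (X.space.presheaf.map i.op).hom s ∈ sumWeight χ X V h}
      zero_mem' := fun x hx => ⟨W, 𝟙 W, hx, by rw [map_zero]; exact zero_mem _⟩
      smul_mem' := by
        intro c s hs x hx
        obtain ⟨V, i, hV, h1⟩ := hs x hx
        exact ⟨V, i, hV, by rw [map_smul]; exact Submodule.smul_mem _ c h1⟩
      add_mem' := by
        intro s t hs ht x hx
        obtain ⟨V, i, hV, h1⟩ := hs x hx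
        obtain ⟨V', i', hV', h2⟩ := ht x hx
        have j : V ⊓ V' ⟶ V := homOfLE inf_le_left
        have j' : V ⊓ V' ⟶ V' := homOfLE inf_le_right
        refine ⟨V ⊓ V', j ≫ i, ⟨hV, hV'⟩, ?_⟩
        rw [map_add]
        refine Submodule.add_mem _ ?_ ?_
        · rw [← res_res X.space j i]
          exact sumWeight_res χ X j h _ h1
        · rw [← res_res X.space j' i']
          exact sumWeight_res χ X j' h _ h2 }
  weight_res := by
    intro V W i h s hs x hx
    obtain ⟨V', i', hV', h1⟩ := hs x (i.le hx)
    have j : V ⊓ V' ⟶ V := homOfLE inf_le_left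
    have j' : V ⊓ V' ⟶ V' := homOfLE inf_le_right
    refine ⟨V ⊓ V', j, ⟨hx, hV'⟩, ?_⟩
    rw [res_res X.space j i (j' ≫ i'), ← res_res X.space j' i']
    exact sumWeight_res χ X j' h _ h1
  weight_loc := by
    intro W h s hs x hx
    obtain ⟨V, i, hV, h1⟩ := hs x hx
    obtain ⟨V', i', hV', h2⟩ := h1 x hV
    refine ⟨V', i' ≫ i, hV', ?_⟩
    rw [← res_res X.space i' i]
    exact h2
  one_mem := by
    intro W x hx
    refine ⟨W, 𝟙 W, hx, ?_⟩
    rw [map_one]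
    exact Submodule.mem_iSup_of_mem ⟨0, map_zero χ⟩ (X.one_mem W)
  mul_mem := by
    intro W h h' s t hs ht x hx
    obtain ⟨V, i, hV, h1⟩ := hs x hx
    obtain ⟨V', i', hV', h2⟩ := ht x hx
    have j : V ⊓ V' ⟶ V := homOfLE inf_le_left
    have j' : V ⊓ V' ⟶ V' := homOfLE inf_le_right
    refine ⟨V ⊓ V', j ≫ i, ⟨hV, hV'⟩, ?_⟩
    rw [map_mul]
    refine sumWeight_mul χ X _ h h' _ _ ?_ ?_
    · rw [← res_res X.space j i]
      exact sumWeight_res χ X j h _ h1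
    · rw [← res_res X.space j' i']
      exact sumWeight_res χ X j' h' _ h2

end GradedSpace

/-- A morphism of `G`-graded ringed spaces: a morphism of the underlying ringed spaces that
preserves weights and is local on the stalks of the sheaves of sections of weight `0`. -/
structure GradedHom {𝕜 : Type} [RCLike 𝕜] {G : Type} [AddCommGroup G] (X Y : GradedSpace 𝕜 G) where
  /-- the underlying morphism of ringed spaces -/
  hom : X.space ⟶ Y.space
  map_weight : ∀ (W : Opens Y.space) (g : G) (s : Y.space.presheaf.obj (op W)),
    s ∈ Y.weight W g → GradedSpace.pull hom W s ∈ X.weight ((Opens.map hom.hom.base).obj W) g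
  isLocal : ∀ (W : Opens Y.space) (s : Y.space.presheaf.obj (op W)), s ∈ Y.weight W 0 →
    ∀ x : X.space, hom.hom.base x ∈ W → X.IsUnitNear (GradedSpace.pull hom W s) x →
      Y.IsUnitNear s (hom.hom.base x)

/-! ### Graded domains -/

section Domain

variable {𝕜 : Type} [RCLike 𝕜] {G : Type} [AddCommGroup G]

/-- The index set of the coordinates of non-zero weight: `d g` of them for each weight `g ≠ 0`. -/
abbrev Coord (d : G → ℕ) : Type := Σ g : {g : G // g ≠ 0}, Fin (d g.1)

/-- The weight of a coordinate. -/
def Coord.wt {d : G → ℕ} (i : Coord d) : G := i.1.1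

/-- The parity of a coordinate, determined by its weight. -/
def Coord.par (π : G → ZMod 2) {d : G → ℕ} (i : Coord d) : ZMod 2 := π i.wt

variable (𝕜) in
/-- The super-symmetric algebra on the coordinates of non-zero weight. -/
abbrev FibreAlg (π : G → ZMod 2) (d : G → ℕ) : Type :=
  SuperSym 𝕜 (Coord.par π : Coord d → ZMod 2)

variable (π : G → ZMod 2) (d : G → ℕ) (U : Opens (Fin (d 0) → 𝕜))

/-- A function with values in the fibre algebra is a section of the structure sheaf of the graded
domain if it is locally a finite sum `∑ f_j a_j` with `f_j` smooth (over `ℝ`) or holomorphic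
(over `ℂ`) functions of the coordinates of weight `0` and `a_j` in the fibre algebra.
These functions form the sheaf associated with `W ↦ C^∞(W) ⊗ S^*(V)`. -/
def IsSection {W : Opens (TopCat.of U)} (s : W → FibreAlg 𝕜 π d) : Prop :=
  ∀ x : W, ∃ W' : Opens (Fin (d 0) → 𝕜), (x.1.1 : Fin (d 0) → 𝕜) ∈ W' ∧
    ∃ (J : Type) (_ : Fintype J) (f : J → (Fin (d 0) → 𝕜) → 𝕜) (a : J → FibreAlg 𝕜 π d),
      (∀ j, ContDiffOn 𝕜 ∞ (f j) W') ∧ ∀ y : W, y.1.1 ∈ W' → s y = ∑ j, f j y.1.1 • a j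

/-- The sections of the structure sheaf over `W`, an algebra under pointwise operations. -/
def sections (W : Opens (TopCat.of U)) : Subalgebra 𝕜 (W → FibreAlg 𝕜 π d) where
  carrier := {s | IsSection π d U s}
  mul_mem' := by
    intro s t hs ht x
    obtain ⟨W₁, h₁, J₁, _, f₁, a₁, hf₁, e₁⟩ := hs x
    obtain ⟨W₂, h₂, J₂, _, f₂, a₂, hf₂, e₂⟩ := ht x
    refine ⟨W₁ ⊓ W₂, ⟨h₁, h₂⟩, J₁ × J₂, inferInstance, fun j z => f₁ j.1 z * f₂ j.2 z,
      fun j => a₁ j.1 * a₂ j.2, fun j => ?_, fun y hy => ?_⟩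
    · exact ((hf₁ j.1).mono fun z hz => hz.1).mul ((hf₂ j.2).mono fun z hz => hz.2)
    · rw [Pi.mul_apply, e₁ y hy.1, e₂ y hy.2, Finset.sum_mul_sum, Fintype.sum_prod_type]
      simp only [smul_mul_smul_comm]
  add_mem' := by
    intro s t hs ht x
    obtain ⟨W₁, h₁, J₁, _, f₁, a₁, hf₁, e₁⟩ := hs x
    obtain ⟨W₂, h₂, J₂, _, f₂, a₂, hf₂, e₂⟩ := ht x
    refine ⟨W₁ ⊓ W₂, ⟨h₁, h₂⟩, J₁ ⊕ J₂, inferInstance, Sum.elim f₁ f₂, Sum.elim a₁ a₂,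
      ?_, fun y hy => ?_⟩
    · rintro (j | j)
      · exact (hf₁ j).mono fun z hz => hz.1
      · exact (hf₂ j).mono fun z hz => hz.2
    · rw [Pi.add_apply, e₁ y hy.1, e₂ y hy.2, Fintype.sum_sum_type]
      simp only [Sum.elim_inl, Sum.elim_inr]
  algebraMap_mem' := by
    intro c x
    refine ⟨⊤, trivial, Unit, inferInstance, fun _ _ => c, fun _ => 1,
      fun _ => contDiffOn_const, fun y _ => ?_⟩
    simp [Algebra.algebraMap_eq_smul_one]

theorem IsSection.res {V W : Opens (TopCat.of U)} (i : V ≤ W) {s : W → FibreAlg 𝕜 π d}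
    (hs : IsSection π d U s) : IsSection π d U (fun y : V => s ⟨y.1, i y.2⟩) := by
  intro x
  obtain ⟨W', h, J, hJ, f, a, hf, e⟩ := hs ⟨x.1, i x.2⟩
  exact ⟨W', h, J, hJ, f, a, hf, fun y hy => e ⟨y.1, i y.2⟩ hy⟩

/-- Restriction of sections. -/
def sectionsRes {V W : Opens (TopCat.of U)} (i : V ≤ W) :
    sections π d U W →ₐ[𝕜] sections π d U V where
  toFun s := ⟨fun y => s.1 ⟨y.1, i y.2⟩, IsSection.res π d U i s.2⟩
  map_one' := rfl
  map_mul' _ _ := rfl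
  map_zero' := rfl
  map_add' _ _ := rfl
  commutes' _ := rfl

/-- The structure sheaf of the graded domain, as a presheaf. -/
def structurePresheaf : TopCat.Presheaf (AlgCat.{0} 𝕜) (TopCat.of U) where
  obj W := AlgCat.of 𝕜 (sections π d U W.unop)
  map i := AlgCat.ofHom (sectionsRes π d U i.unop.le)
  map_id _ := rfl
  map_comp _ _ := rfl

/-- Being a section is a local condition. -/
def sectionPredicate : TopCat.LocalPredicate fun _ : TopCat.of U => FibreAlg 𝕜 π d where
  pred s := IsSection π d U s
  res i _ hs := IsSection.res π d U i.le hs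
  locality := by
    intro W s hs x
    obtain ⟨V, hxV, i, h⟩ := hs x
    obtain ⟨W', h', J, hJ, f, a, hf, e⟩ := h ⟨x.1, hxV⟩
    obtain ⟨V₀, hV₀, hV⟩ := isOpen_induced_iff.1 V.2
    refine ⟨W' ⊓ ⟨V₀, hV₀⟩, ⟨h', ?_⟩, J, hJ, f, a,
      fun j => (hf j).mono fun z hz => hz.1, fun y hy => ?_⟩
    · have : x.1 ∈ V.carrier := hxV
      rw [← hV] at this
      exact this
    · have : y.1 ∈ V.carrier := by
        rw [← hV]
        exact hy.2
      exact e ⟨y.1, this⟩ hy.1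

theorem structurePresheaf_isSheaf : (structurePresheaf π d U).IsSheaf :=
  (TopCat.Presheaf.isSheaf_iff_isSheaf_comp (CategoryTheory.forget (AlgCat.{0} 𝕜)) _).2
    (TopCat.Presheaf.isSheaf_of_iso
      (NatIso.ofComponents (fun _ => Iso.refl _) (fun _ => rfl))
      (TopCat.subpresheafToTypes.isSheaf (sectionPredicate π d U)))

/-- The graded domain over the open set `U`, with `d g` coordinates of weight `g` for every `g`
(those of weight `0` being the coordinates of `U`), the parity of a coordinate of weight `g`
being `π g`. -/
def gradedDomain : GradedSpace 𝕜 G where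
  space :=
    { carrier := TopCat.of U
      presheaf := structurePresheaf π d U
      IsSheaf := structurePresheaf_isSheaf π d U }
  weight W g :=
    { carrier := {s : sections π d U W |
        ∀ x : W, s.1 x ∈ SuperSym.homogeneous 𝕜 (Coord.par π) Coord.wt g}
      zero_mem' := fun _ => zero_mem _
      add_mem' := fun hs ht x => add_mem (hs x) (ht x)
      smul_mem' := fun c _ hs x => Submodule.smul_mem _ c (hs x) }
  weight_res i _ _ hs x := hs ⟨x.1, i.le x.2⟩
  weight_loc W g s hs x := by
    obtain ⟨V, i, hV, h⟩ := hs x.1 x.2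
    exact h ⟨x.1, hV⟩
  one_mem _ _ := SuperSym.one_mem_homogeneous _ _
  mul_mem _ _ _ _ _ hs ht x := SuperSym.mul_mem_homogeneous _ _ (hs x) (ht x)

end Domain

/-! ### Graded manifolds and `n`-fold vector bundles -/

section Manifold

variable {𝕜 : Type} [RCLike 𝕜] {G : Type} [AddCommGroup G]

/-- A chart of `X`: an isomorphism, preserving the gradings, of a graded ringed space with an open
subspace of `X`. -/
structure IsChart {D X : GradedSpace 𝕜 G} (c : GradedHom D X) : Prop where
  isOpenImmersion : SheafedSpace.IsOpenImmersion c.hom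
  weight_of_pull : ∀ (W : Opens X.space), (W : Set X.space) ⊆ Set.range c.hom.hom.base →
    ∀ (g : G) (s : X.space.presheaf.obj (op W)),
      GradedSpace.pull c.hom W s ∈ D.weight ((Opens.map c.hom.hom.base).obj W) g →
        s ∈ X.weight W g

/-- `X` is a graded manifold with coordinates of parities given by `π`, with `d g` local
coordinates of weight `g` for every `g`: its base is Hausdorff and second countable, and it is
locally isomorphic to graded domains with these numbers of coordinates. -/
structure IsGradedManifold (π : G → ZMod 2) (d : G → ℕ) (X : GradedSpace 𝕜 G) : Prop where
  t2 : T2Space X.space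
  secondCountable : SecondCountableTopology X.space
  charts : ∀ x : X.space, ∃ (U : Opens (Fin (d 0) → 𝕜)) (c : GradedHom (gradedDomain π d U) X),
    IsChart c ∧ x ∈ Set.range c.hom.hom.base

/-- The parity of the weight `kβ`, where `β` has parity `ε`. -/
def parZ (ε : ZMod 2) (k : ℤ) : ZMod 2 := k * ε

/-- The parity of the weight `k_1 α_1 + ⋯ + k_n α_n`, where all `α_i` have parity `ε`. -/
def parMulti (ε : ZMod 2) {n : ℕ} (δ : Fin n → ℤ) : ZMod 2 := ∑ i, δ i * ε

/-- The multiplicity-free weights in `ℤⁿ`: all coefficients are `0` or `1`. -/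
def multFree (n : ℕ) : Set (Fin n → ℤ) := {δ | ∀ i, δ i = 0 ∨ δ i = 1}

/-- `N` is a (`ℤ`-)graded manifold of degree `n`, with `d k` coordinates of weight `k`;
all weights lie between `0` and `n`. -/
def IsGradedManifoldOfDegree (ε : ZMod 2) (n : ℕ) (d : ℤ → ℕ) (N : GradedSpace 𝕜 ℤ) : Prop :=
  Function.support d ⊆ Set.Icc 0 (n : ℤ) ∧ IsGradedManifold (parZ ε) d N

/-- `Q` is an `n`-fold vector bundle, in the description by homogeneous coordinates: a `ℤⁿ`-graded manifold whose local coordinates have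
multiplicity-free weights. -/
def IsNFoldVectorBundle (ε : ZMod 2) (n : ℕ) (Q : GradedSpace 𝕜 (Fin n → ℤ)) : Prop :=
  ∃ d : (Fin n → ℤ) → ℕ, Function.support d ⊆ multFree n ∧ IsGradedManifold (parMulti ε) d Q

/-- The homomorphism `(k_1, …, k_n) ↦ k_1 + ⋯ + k_n`. -/
def totalDegree (n : ℕ) : (Fin n → ℤ) →+ ℤ where
  toFun δ := ∑ i, δ i
  map_zero' := by simp
  map_add' _ _ := by simp [Finset.sum_add_distrib]

/-- A `ℤⁿ`-graded ringed space with its `ℤ`-grading by total degree. -/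
abbrev GradedSpace.total {n : ℕ} (D : GradedSpace 𝕜 (Fin n → ℤ)) : GradedSpace 𝕜 ℤ :=
  D.collapse (totalDegree n)

/-- `q : Q → N` is a covering of `N` in the category of `n`-fold vector bundles: `Q` is an `n`-fold
vector bundle, and every `ℤ`-graded morphism from an `n`-fold vector bundle to `N` factors through
`q` by a unique morphism of `n`-fold vector bundles. -/
def IsCovering (ε : ZMod 2) {n : ℕ} {N : GradedSpace 𝕜 ℤ} (Q : GradedSpace 𝕜 (Fin n → ℤ))
    (q : GradedHom Q.total N) : Prop :=
  IsNFoldVectorBundle ε n Q ∧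
    ∀ D : GradedSpace 𝕜 (Fin n → ℤ), IsNFoldVectorBundle ε n D →
      ∀ φ : GradedHom D.total N, ∃! Φ : GradedHom D Q, Φ.hom ≫ q.hom = φ.hom

/-- One coordinate in each of the weights `0`, `1`, `2`. -/
def dimXi (k : ℤ) : ℕ := if k = 0 ∨ k = 1 ∨ k = 2 then 1 else 0

end Manifold

end GradedGeometry

end

open GradedGeometry

/-!
Let `N` have a coordinate `ξ` of weight `k ≥ 2`. A product `e₁ e₂` of two coordinates of an `n`-fold
vector bundle can have total degree `k` although its weight is not multiplicity-free; such a product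
is a possible value of `ξ` under a `ℤ`-graded morphism to `N`, but it is invisible to the morphisms
of `n`-fold vector bundles, as the following argument shows.

The test bundle has a point as base and coordinates whose weights are multiplicity-free with a
fixed component `i₀` equal to `1`. Choose two distinct coordinates `e₁`, `e₂` of it whose weights
have total degrees adding up to `k` (`exists_multFree_totalDegree_add`). In a chart of `N` let `φ`
send the base to a point, `ξ` to `e₁ e₂` and the other coordinates of non-zero weight to `0`. The
rescaling `σ` of the test bundle which multiplies `e₂` by `1/2` and all other coordinates by `2`
satisfies `φ ∘ σ = φ`. So, if `q : Q → N` is a covering and `φ = q ∘ Φ`, then `Φ ∘ σ = Φ` by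
uniqueness.

A coordinate of `Q` of non-zero multiplicity-free weight `δ` pulls back under `Φ` to an element of
weight `δ` that `σ` fixes. It is `0`: if `δ i₀ = 0`, nothing but `0` has weight `δ`
(`SuperSym.eq_zero_of_mem_homogeneous`), and if `δ i₀ = 1`, the element is linear in the
coordinates, and no non-zero linear element is fixed (`SuperSym.eq_zero_of_scale_eq`). Functions of
weight `0` pull back to scalars. Since `Q` is locally a graded domain, all its sections pull back to
scalars (`IsChart.exists_eq_algebraMap`). But the section `q^* ξ` of `Q` pulls back to `e₁ e₂`,
which is not a scalar (`SuperSym.gen_mul_gen_ne_algebraMap`).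
-/

noncomputable section

namespace GradedGeometry

/-! ### The super-symmetric algebra -/

namespace SuperSym

variable {𝕜 : Type} [RCLike 𝕜] {κ : Type} {par : κ → ZMod 2}
  {A : Type*} [Ring A] [Algebra 𝕜 A]

/-- The universal property of the super-symmetric algebra. -/
def lift (f : κ → A) (hf : ∀ i j, f i * f j = (-1 : 𝕜) ^ (par i * par j).val • (f j * f i)) :
    SuperSym 𝕜 par →ₐ[𝕜] A :=
  RingQuot.liftAlgHom 𝕜 ⟨FreeAlgebra.lift 𝕜 f, by
    rintro _ _ ⟨i, j⟩
    simpa using hf i j⟩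

@[simp]
theorem lift_gen (f : κ → A)
    (hf : ∀ i j, f i * f j = (-1 : 𝕜) ^ (par i * par j).val • (f j * f i)) (i : κ) :
    lift (par := par) f hf (gen 𝕜 par i) = f i := by
  unfold lift gen
  erw [RingQuot.liftAlgHom_mkAlgHom_apply]
  simp

theorem gen_mul_gen (i j : κ) : gen 𝕜 par i * gen 𝕜 par j =
    (-1 : 𝕜) ^ (par i * par j).val • (gen 𝕜 par j * gen 𝕜 par i) := by
  have h := RingQuot.mkAlgHom_rel 𝕜 (SuperRel.comm (𝕜 := 𝕜) (par := par) i j)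
  rw [map_mul, map_smul, map_mul] at h
  exact h

theorem algHom_ext {f g : SuperSym 𝕜 par →ₐ[𝕜] A}
    (h : ∀ i, f (gen 𝕜 par i) = g (gen 𝕜 par i)) : f = g :=
  RingQuot.ringQuot_ext' 𝕜 _ _ (FreeAlgebra.hom_ext (funext h))

/-- The augmentation, sending all generators to `0`. -/
def aug : SuperSym 𝕜 par →ₐ[𝕜] 𝕜 := lift (fun _ => 0) (by simp)

/-- The endomorphism multiplying the `i`-th generator by `c i`. -/
def scale (c : κ → 𝕜) : SuperSym 𝕜 par →ₐ[𝕜] SuperSym 𝕜 par :=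
  lift (fun i => c i • gen 𝕜 par i) fun i j => by
    rw [smul_mul_smul_comm, smul_mul_smul_comm, gen_mul_gen i j, smul_comm, mul_comm (c i)]

@[simp]
theorem scale_gen (c : κ → 𝕜) (i : κ) :
    scale c (gen 𝕜 par i) = c i • gen 𝕜 par i := lift_gen _ _ i

/-- An algebra homomorphism that kills the generators factors through the augmentation. -/
theorem algHom_eq_algebraMap_aug (f : SuperSym 𝕜 par →ₐ[𝕜] A)
    (h : ∀ i, f (gen 𝕜 par i) = 0) (a : SuperSym 𝕜 par) : f a = algebraMap 𝕜 A (aug a) := by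
  have : f = (Algebra.ofId 𝕜 A).comp aug :=
    algHom_ext fun i => by simp [h, aug]
  rw [this]
  rfl

theorem gen_mul_gen_self {i : κ} (hi : par i = 1) : gen 𝕜 par i * gen 𝕜 par i = 0 := by
  have h := gen_mul_gen (𝕜 := 𝕜) (par := par) i i
  have h1 : ((1 : ZMod 2) * 1).val = 1 := rfl
  rw [hi, h1, pow_one, neg_smul, one_smul] at h
  have h2 : (2 : 𝕜) • (gen 𝕜 par i * gen 𝕜 par i) = 0 := by
    rw [two_smul]
    nth_rewrite 1 [h]
    exact neg_add_cancel _
  exact (smul_eq_zero.1 h2).resolve_left two_ne_zero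

/-- Two distinct generators have a non-zero product: it acts non-trivially on the
four-dimensional module with basis `1, x, y, xy`, in which `x ^ 2 = y ^ 2 = 0`. -/
theorem gen_mul_gen_ne_zero {i j : κ} (hij : i ≠ j) : gen 𝕜 par i * gen 𝕜 par j ≠ 0 := by
  classical
  let t : 𝕜 := (-1) ^ (par i * par j).val
  have ht : t * t = 1 := by
    rw [← mul_pow]
    simp
  let X : Matrix (Fin 4) (Fin 4) 𝕜 := !![0, 0, 0, 0; 1, 0, 0, 0; 0, 0, 0, 0; 0, 0, 1, 0]
  let Y : Matrix (Fin 4) (Fin 4) 𝕜 := !![0, 0, 0, 0; 0, 0, 0, 0; 1, 0, 0, 0; 0, t, 0, 0]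
  have hXX : X * X = 0 := by
    ext a b
    fin_cases a <;> fin_cases b <;> simp [X, Matrix.mul_apply, Fin.sum_univ_four]
  have hYY : Y * Y = 0 := by
    ext a b
    fin_cases a <;> fin_cases b <;> simp [Y, Matrix.mul_apply, Fin.sum_univ_four]
  have hYX : Y * X = t • (X * Y) := by
    ext a b
    fin_cases a <;> fin_cases b <;> simp [X, Y, Matrix.mul_apply, Fin.sum_univ_four]
  have hXY : X * Y = t • (Y * X) := by
    rw [hYX, smul_smul, ht, one_smul]
  let f : κ → Matrix (Fin 4) (Fin 4) 𝕜 := fun m => if m = i then X else if m = j then Y else 0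
  have hf : ∀ a b, f a * f b = (-1 : 𝕜) ^ (par a * par b).val • (f b * f a) := by
    intro a b
    simp only [f]
    split_ifs with ha hb hb' hb hb' hb'
    · rw [hXX, smul_zero]
    · rw [ha, hb', ← hXY]
    · rw [mul_zero, zero_mul, smul_zero]
    · rw [hb, hb', mul_comm (par j)]
      exact hYX
    · rw [hYY, smul_zero]
    all_goals simp
  intro h0
  have h1 : lift (par := par) f hf (gen 𝕜 par i * gen 𝕜 par j) = X * Y := by
    rw [map_mul, lift_gen, lift_gen]
    simp [f, hij.symm]
  rw [h0, map_zero] at h1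
  have h2 := congrFun (congrFun h1 3) 0
  simp [X, Y, Matrix.mul_apply, Fin.sum_univ_four] at h2

/-- The homomorphism which maps the generator `ξ` to the product of the generators `i` and `j`, of
the same parity, and kills the other generators. -/
def liftMul {κ' : Type} {par' : κ' → ZMod 2} (ξ : κ) (i j : κ') (h : par ξ = par' i + par' j) :
    SuperSym 𝕜 par →ₐ[𝕜] SuperSym 𝕜 par' :=
  open Classical in
  lift (fun m => if m = ξ then gen 𝕜 par' i * gen 𝕜 par' j else 0) fun a b => by
    by_cases ha : a = ξ
    · by_cases hb : b = ξ
      · rw [if_pos ha, if_pos hb, ha, hb]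
        -- either `ξ` is even, or one of the factors is odd and the square vanishes
        have hcases : ∀ p q : ZMod 2, (p + q) * (p + q) = 0 ∨ p = 1 ∨ q = 1 := by decide
        have hsq : gen 𝕜 par' i * gen 𝕜 par' j * (gen 𝕜 par' i * gen 𝕜 par' j) =
            (-1 : 𝕜) ^ (par' j * par' i).val • (gen 𝕜 par' i * gen 𝕜 par' i *
              (gen 𝕜 par' j * gen 𝕜 par' j)) := by
          rw [mul_assoc, ← mul_assoc (gen 𝕜 par' j), gen_mul_gen j i, smul_mul_assoc,
            mul_smul_comm]
          simp only [mul_assoc]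
        rcases hcases (par' i) (par' j) with h0 | h0 | h0
        · rw [h, h0]
          simp
        · rw [hsq, gen_mul_gen_self h0]
          simp
        · rw [hsq, gen_mul_gen_self h0]
          simp
      · rw [if_neg hb]
        simp
    · rw [if_neg ha]
      simp

theorem liftMul_gen_self {κ' : Type} {par' : κ' → ZMod 2} {ξ : κ} {i j : κ'}
    (h : par ξ = par' i + par' j) :
    liftMul ξ i j h (gen 𝕜 par ξ) = gen 𝕜 par' i * gen 𝕜 par' j := by
  rw [liftMul, lift_gen, if_pos rfl]

theorem liftMul_gen_of_ne {κ' : Type} {par' : κ' → ZMod 2} {ξ m : κ} {i j : κ'}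
    (h : par ξ = par' i + par' j) (hm : m ≠ ξ) :
    liftMul ξ i j h (gen 𝕜 par m) = 0 := by
  rw [liftMul, lift_gen, if_neg hm]

/-- The product of two distinct generators is not a scalar: doubling the first one
would fix a scalar. -/
theorem gen_mul_gen_ne_algebraMap {i j : κ} (hij : i ≠ j) (c : 𝕜) :
    gen 𝕜 par i * gen 𝕜 par j ≠ algebraMap 𝕜 _ c := by
  classical
  intro h
  have h1 := congrArg (scale (par := par) fun m => if m = i then (2 : 𝕜) else 1) h
  rw [map_mul, scale_gen, scale_gen, AlgHom.commutes, ← h, if_pos rfl, if_neg hij.symm, one_smul,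
    smul_mul_assoc, two_smul] at h1
  exact gen_mul_gen_ne_zero hij (by simpa using h1)

section Weights

variable {G : Type} [AddCommGroup G] {wt : κ → G}

theorem gen_mem_homogeneous (i : κ) : gen 𝕜 par i ∈ homogeneous 𝕜 par wt (wt i) :=
  Submodule.subset_span ⟨[i], by simp, by simp⟩

/-- If no non-empty product of generators has weight `0`, the elements of weight `0` are the
scalars. -/
theorem eq_algebraMap_of_mem_homogeneous_zero
    (h : ∀ l : List κ, (l.map wt).sum = 0 → l = []) {a : SuperSym 𝕜 par}
    (ha : a ∈ homogeneous 𝕜 par wt 0) : a = algebraMap 𝕜 _ (aug a) := by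
  have hle : homogeneous 𝕜 par wt 0 ≤ LinearMap.eqLocus LinearMap.id
      ((Algebra.linearMap 𝕜 (SuperSym 𝕜 par)).comp (aug (par := par)).toLinearMap) := by
    refine Submodule.span_le.2 ?_
    rintro _ ⟨l, hl, rfl⟩
    rw [h l hl]
    simp
  exact hle ha

theorem eq_nil_of_map_sum_eq_zero (χ : G →+ ℤ) (hχ : ∀ i, 0 < χ (wt i)) (l : List κ)
    (hl : χ (l.map wt).sum = 0) : l = [] := by
  cases l with
  | nil => rfl
  | cons i l =>
    have h1 : 0 ≤ ((l.map wt).map χ).sum := List.sum_nonneg (by simpa using fun i _ => (hχ i).le)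
    rw [map_list_sum, List.map_cons, List.map_cons, List.sum_cons] at hl
    have := hχ i
    omega

theorem eq_zero_of_mem_homogeneous (χ : G →+ ℤ) (hχ : ∀ i, 0 < χ (wt i)) {w : G} (hw : χ w = 0)
    (hw0 : w ≠ 0) {a : SuperSym 𝕜 par} (ha : a ∈ homogeneous 𝕜 par wt w) : a = 0 := by
  have hle : homogeneous 𝕜 par wt w ≤ ⊥ := by
    refine Submodule.span_le.2 ?_
    rintro _ ⟨l, rfl, rfl⟩
    rw [eq_nil_of_map_sum_eq_zero χ hχ l hw] at hw0
    exact absurd rfl hw0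
  exact hle ha

/-- Suppose that all generators have degree `1` with respect to `χ`. Then the elements of degree
`1` are linear in the generators, so that one of them fixed by a rescaling of the generators by
factors `b, c ≠ 1` vanishes. -/
theorem eq_zero_of_scale_eq (χ : G →+ ℤ) (hχ : ∀ i, χ (wt i) = 1) {r : κ → 𝕜} {b c : 𝕜}
    (hb : b ≠ 1) (hc : c ≠ 1) (hr : ∀ i, r i = b ∨ r i = c) {w : G} (hw : χ w = 1)
    {a : SuperSym 𝕜 par} (ha : a ∈ homogeneous 𝕜 par wt w) (h : scale r a = a) : a = 0 := by
  -- the quadratic polynomial with the roots `b` and `c` in the rescaling kills all generators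
  let σ : SuperSym 𝕜 par →ₗ[𝕜] SuperSym 𝕜 par := (scale r).toLinearMap
  have hle : homogeneous 𝕜 par wt w ≤ LinearMap.ker ((σ - b • 1) * (σ - c • 1)) := by
    refine Submodule.span_le.2 ?_
    rintro _ ⟨l, hl, rfl⟩
    have h1 : (l.length : ℤ) = 1 := by
      rw [← hw, ← hl, map_list_sum, List.map_map]
      have : χ ∘ wt = fun _ => 1 := funext hχ
      simp [this]
    obtain ⟨i, rfl⟩ := List.length_eq_one_iff.1 (by exact_mod_cast h1)
    rcases hr i with hi | hi <;>
      simp [σ, hi, smul_sub, smul_smul, mul_comm]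
  have h1 := hle ha
  have hσ : σ a = a := h
  have h2 : ((1 - b) * (1 - c)) • a = 0 := by
    rw [← LinearMap.mem_ker.1 h1]
    simp only [Module.End.mul_apply, LinearMap.sub_apply, LinearMap.smul_apply,
      Module.End.one_apply, map_sub, map_smul, hσ]
    module
  refine (smul_eq_zero.1 h2).resolve_left (mul_ne_zero ?_ ?_) <;> rw [sub_ne_zero] <;>
    exact Ne.symm ‹_›

end Weights

end SuperSym

/-! ### Morphisms of graded ringed spaces -/

/-- Pull-back of sections commutes with restriction. -/
theorem pull_res {𝕜 : Type} [RCLike 𝕜] {X Y : SheafedSpace (AlgCat.{0} 𝕜)} (f : X ⟶ Y)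
    {V W : Opens Y} (i : V ⟶ W) (s : Y.presheaf.obj (op W)) :
    GradedSpace.pull f V ((Y.presheaf.map i.op).hom s) =
      (X.presheaf.map ((Opens.map f.hom.base).map i).op).hom (GradedSpace.pull f W s) :=
  congrArg (fun g => g.hom s) (f.hom.c.naturality i.op)

section Hom

variable {𝕜 : Type} [RCLike 𝕜] {G : Type} [AddCommGroup G]

/-- The composition of morphisms of graded ringed spaces. -/
def GradedHom.comp {X Y Z : GradedSpace 𝕜 G} (f : GradedHom X Y) (g : GradedHom Y Z) :
    GradedHom X Z where
  hom := f.hom ≫ g.hom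
  map_weight W w s hs := f.map_weight _ w _ (g.map_weight W w s hs)
  isLocal W s hs x hx h :=
    g.isLocal W s hs _ hx (f.isLocal _ _ (g.map_weight W 0 s hs) x hx h)

variable (𝕜) in
/-- The identity morphism of a graded ringed space. -/
def GradedHom.id (X : GradedSpace 𝕜 G) : GradedHom X X where
  hom := 𝟙 X.space
  map_weight _ _ _ hs := hs
  isLocal _ _ _ _ _ h := h

theorem isChart_id (X : GradedSpace 𝕜 G) : IsChart (GradedHom.id 𝕜 X) where
  isOpenImmersion := inferInstanceAs (SheafedSpace.IsOpenImmersion (𝟙 X.space))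
  weight_of_pull _ _ _ _ hs := hs

theorem isGradedManifold_gradedDomain (π : G → ZMod 2) (d : G → ℕ) (U : Opens (Fin (d 0) → 𝕜)) :
    IsGradedManifold π d (gradedDomain π d U) where
  t2 := inferInstanceAs (T2Space U)
  secondCountable := inferInstanceAs (SecondCountableTopology U)
  charts x := ⟨U, GradedHom.id 𝕜 _, isChart_id _, x, rfl⟩

end Hom

/-! ### Morphisms of graded domains over a constant map -/

section ConstHom

variable {𝕜 : Type} [RCLike 𝕜] {G H : Type} [AddCommGroup G] [AddCommGroup H]
  {π : G → ZMod 2} {d : G → ℕ} {U : Opens (Fin (d 0) → 𝕜)}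
  {π' : H → ZMod 2} {d' : H → ℕ} {U' : Opens (Fin (d' 0) → 𝕜)}

/-- A constant function with values in the fibre algebra, as a section. -/
def constSection (W : Opens (TopCat.of U)) :
    FibreAlg 𝕜 π d →ₐ[𝕜] (gradedDomain π d U).space.presheaf.obj (op W) where
  toFun a := ⟨fun _ => a, fun _ => ⟨⊤, trivial, Unit, inferInstance, fun _ _ => 1, fun _ => a,
    fun _ => contDiffOn_const, fun _ _ => by simp⟩⟩
  map_one' := rfl
  map_mul' _ _ := rfl
  map_zero' := rfl
  map_add' _ _ := rfl
  commutes' _ := rfl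

/-- The value of a section at a point, as an element of the fibre algebra. -/
def evalSection {W : Opens (TopCat.of U)} (u : TopCat.of U) (hu : u ∈ W) :
    (gradedDomain π d U).space.presheaf.obj (op W) →ₐ[𝕜] FibreAlg 𝕜 π d :=
  (Pi.evalAlgHom 𝕜 (fun _ : W => FibreAlg 𝕜 π d) ⟨u, hu⟩).comp (sections π d U W).val

/-- The morphism of ringed spaces between graded domains which maps the base to the point `u`, and
a section to the constant section whose value is the image under `θ` of its value at `u`. -/
def constHom (u : TopCat.of U) (θ : FibreAlg 𝕜 π d →ₐ[𝕜] FibreAlg 𝕜 π' d') :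
    (gradedDomain π' d' U').space ⟶ (gradedDomain π d U).space :=
  InducedCategory.homMk
    { base := TopCat.ofHom (ContinuousMap.const _ u)
      c :=
        { app W := AlgCat.ofHom
            { toFun s := ⟨fun y => θ (s.1 ⟨u, y.2⟩), fun x =>
                ⟨⊤, trivial, Unit, inferInstance, fun _ _ => 1, fun _ => θ (s.1 ⟨u, x.2⟩),
                  fun _ => contDiffOn_const, fun _ _ => by simp⟩⟩
              map_one' := Subtype.ext (funext fun _ => map_one θ)
              map_mul' _ _ := Subtype.ext (funext fun _ => map_mul θ _ _)
              map_zero' := Subtype.ext (funext fun _ => map_zero θ)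
              map_add' _ _ := Subtype.ext (funext fun _ => map_add θ _ _)
              commutes' c := Subtype.ext (funext fun _ => AlgHom.commutes θ c) }
          naturality _ _ _ := rfl } }

theorem constHom_comp (u : TopCat.of U) (u' : TopCat.of U')
    (θ : FibreAlg 𝕜 π d →ₐ[𝕜] FibreAlg 𝕜 π' d')
    (σ : FibreAlg 𝕜 π' d' →ₐ[𝕜] FibreAlg 𝕜 π' d') :
    constHom (U' := U') u' σ ≫ constHom u θ = constHom u (σ.comp θ) := rfl

/-- If no non-empty product of the coordinates of the target has weight `0`, its sections of
weight `0` are functions, and such a function is invertible near `u` if its value at `u` is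
not `0`. -/
theorem isUnitNear_of_constHom (hd : ∀ l : List (Coord d), (l.map Coord.wt).sum = 0 → l = [])
    [Nontrivial (FibreAlg 𝕜 π' d')]
    (u : TopCat.of U) (θ : FibreAlg 𝕜 π d →ₐ[𝕜] FibreAlg 𝕜 π' d') {W : Opens (TopCat.of U)}
    (s : sections π d U W) (hs : s ∈ (gradedDomain π d U).weight W 0) (hu : u ∈ W)
    
    {V : Opens (gradedDomain π' d' U').space} {x : (gradedDomain π' d' U').space} (hx : x ∈ V)
    (i : V ⟶ (Opens.map (constHom (U' := U') u θ).hom.base).obj W) 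
    (g : (gradedDomain π' d' U').space.presheaf.obj (op V))
    (hg : ((gradedDomain π' d' U').space.presheaf.map i.op).hom
      (GradedSpace.pull (constHom (U' := U') u θ) W s) * g = 1) :
    (gradedDomain π d U).IsUnitNear (W := W) s u := by
  have hs' : ∀ y : W, s.1 y = algebraMap 𝕜 _ (SuperSym.aug (s.1 y)) := fun y =>
    SuperSym.eq_algebraMap_of_mem_homogeneous_zero hd (hs y)
  -- if the value at `u` vanished, then `1 = 0` in the fibre algebra of the source
  have h0 : SuperSym.aug (s.1 ⟨u, hu⟩) ≠ 0 := by
    intro h0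
    have h1 : θ (s.1 ⟨u, hu⟩) * g.1 ⟨x, hx⟩ = 1 :=
      congrArg (evalSection x hx) hg
    rw [hs', h0, map_zero, map_zero, zero_mul] at h1
    exact zero_ne_one h1
  obtain ⟨W', huW', J, _, f, a, hf, e⟩ := s.2 ⟨u, hu⟩
  -- the function that `s` is near `u`, seen to be smooth by augmenting a local presentation of `s`
  let F : (Fin (d 0) → 𝕜) → 𝕜 := fun z => ∑ j, f j z * SuperSym.aug (a j)
  have hF : ContDiffOn 𝕜 ∞ F W' :=
    ContDiffOn.sum fun j _ => (hf j).mul contDiffOn_const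
  have hsF : ∀ y : W, y.1.1 ∈ W' → SuperSym.aug (s.1 y) = F y.1.1 := by
    intro y hy
    rw [e y hy, map_sum]
    simp [F]
  let O : Opens (Fin (d 0) → 𝕜) := ⟨W' ∩ F ⁻¹' {0}ᶜ,
    hF.continuousOn.isOpen_inter_preimage W'.2 isOpen_compl_singleton⟩
  have hOF : ∀ z ∈ O, F z ≠ 0 := fun z hz => hz.2
  let V₀ : Opens (TopCat.of U) :=
    W ⊓ ⟨Subtype.val ⁻¹' (O : Set _), O.2.preimage continuous_subtype_val⟩
  let t : sections π d U V₀ := ⟨fun y => algebraMap 𝕜 _ (F y.1.1)⁻¹, fun x =>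
    ⟨O, x.2.2, Unit, inferInstance, fun _ z => (F z)⁻¹, fun _ => 1,
      fun _ => (hF.mono Set.inter_subset_left).inv hOF,
      fun y _ => by simp [Algebra.algebraMap_eq_smul_one]⟩⟩
  refine ⟨V₀, homOfLE inf_le_left, ⟨hu, huW', ?_⟩, t, fun y => ?_, ?_⟩
  · change F u.1 ≠ 0
    rwa [← hsF ⟨u, hu⟩ huW']
  · change algebraMap 𝕜 _ (F y.1.1)⁻¹ ∈ _
    rw [Algebra.algebraMap_eq_smul_one]
    exact Submodule.smul_mem _ _ (SuperSym.one_mem_homogeneous _ _)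
  · refine Subtype.ext (funext fun y => ?_)
    change s.1 ⟨y.1, y.2.1⟩ * algebraMap 𝕜 _ (F y.1.1)⁻¹ = 1
    rw [hs', hsF _ y.2.2.1, ← map_mul, mul_inv_cancel₀ (hOF _ y.2.2), map_one]

theorem constSection_mem_weight (W : Opens (TopCat.of U)) {g : G} {a : FibreAlg 𝕜 π d}
    (ha : a ∈ SuperSym.homogeneous 𝕜 (Coord.par π) Coord.wt g) :
    constSection W a ∈ (gradedDomain π d U).weight W g := fun _ => ha

/-- If `θ` maps each coordinate into the weight given by `χ`, then it maps homogeneous elements of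
the fibre algebra to constant sections that are sums of homogeneous ones. -/
theorem constSection_mem_sumWeight (χ : H →+ G) (θ : FibreAlg 𝕜 π d →ₐ[𝕜] FibreAlg 𝕜 π' d')
    (W : Opens (TopCat.of U'))
    (hθ : ∀ i : Coord d, constSection W (θ (SuperSym.gen 𝕜 _ i)) ∈
      GradedSpace.sumWeight χ (gradedDomain π' d' U') W i.wt)
    {g : G} {a : FibreAlg 𝕜 π d} (ha : a ∈ SuperSym.homogeneous 𝕜 (Coord.par π) Coord.wt g) :
    constSection W (θ a) ∈ GradedSpace.sumWeight χ (gradedDomain π' d' U') W g := by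
  have hl : ∀ l : List (Coord d),
      constSection W (θ (l.map (SuperSym.gen 𝕜 (Coord.par π))).prod) ∈
        GradedSpace.sumWeight χ (gradedDomain π' d' U') W (l.map Coord.wt).sum := by
    intro l
    induction l with
    | nil =>
      rw [List.map_nil, List.map_nil, List.prod_nil, map_one, List.sum_nil]
      refine Submodule.mem_iSup_of_mem ⟨0, map_zero χ⟩ ?_
      exact constSection_mem_weight W (SuperSym.one_mem_homogeneous _ _)
    | cons i l ih =>
      rw [List.map_cons, List.map_cons, List.prod_cons, List.sum_cons, map_mul, map_mul]
      exact GradedSpace.sumWeight_mul χ (gradedDomain π' d' U') W _ _ _ _ (hθ i) ih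
  have hle : SuperSym.homogeneous 𝕜 (Coord.par π) Coord.wt g ≤
      (GradedSpace.sumWeight χ (gradedDomain π' d' U') W g).comap
        ((constSection W).comp θ).toLinearMap := by
    refine Submodule.span_le.2 ?_
    rintro _ ⟨l, rfl, rfl⟩
    exact hl l
  exact hle ha

/-- `constHom` as a morphism of graded spaces, its source carrying the grading induced by `χ`,
for `θ` mapping each coordinate to a sum of elements of the weights that induce its weight. -/
def constGradedHomCollapse (χ : H →+ G)
    (hd : ∀ l : List (Coord d), (l.map Coord.wt).sum = 0 → l = [])
    [Nontrivial (FibreAlg 𝕜 π' d')] (u : TopCat.of U)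
    (θ : FibreAlg 𝕜 π d →ₐ[𝕜] FibreAlg 𝕜 π' d')
    (hθ : ∀ (W : Opens (TopCat.of U')) (i : Coord d), constSection W (θ (SuperSym.gen 𝕜 _ i)) ∈
      GradedSpace.sumWeight χ (gradedDomain π' d' U') W i.wt) :
    GradedHom ((gradedDomain π' d' U').collapse χ) (gradedDomain π d U) where
  hom := constHom u θ
  map_weight W g s hs x hx := by
    exact ⟨_, 𝟙 _, hx, constSection_mem_sumWeight χ θ _ (hθ _) (hs ⟨u, hx⟩)⟩
  isLocal W s hs x hx := by
    rintro ⟨V, i, hV, g, -, hg⟩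
    exact isUnitNear_of_constHom hd u θ s hs hx hV i g hg

/-- `constHom` as a morphism of graded spaces, for `θ` preserving the weights of the coordinates. -/
def constGradedHom (hd : ∀ l : List (Coord d), (l.map Coord.wt).sum = 0 → l = [])
    {π'' : G → ZMod 2} {d'' : G → ℕ} {U'' : Opens (Fin (d'' 0) → 𝕜)}
    [Nontrivial (FibreAlg 𝕜 π'' d'')] (u : TopCat.of U)
    (θ : FibreAlg 𝕜 π d →ₐ[𝕜] FibreAlg 𝕜 π'' d'')
    (hθ : ∀ i : Coord d, θ (SuperSym.gen 𝕜 _ i) ∈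
      SuperSym.homogeneous 𝕜 (Coord.par π'') Coord.wt i.wt) :
    GradedHom (gradedDomain π'' d'' U'') (gradedDomain π d U) where
  hom := constHom u θ
  map_weight W g s hs := by
    have hl : ∀ l : List (Coord d), θ (l.map (SuperSym.gen 𝕜 (Coord.par π))).prod ∈
        SuperSym.homogeneous 𝕜 (Coord.par π'') Coord.wt (l.map Coord.wt).sum := by
      intro l
      induction l with
      | nil => simpa using SuperSym.one_mem_homogeneous _ _
      | cons i l ih =>
        rw [List.map_cons, List.map_cons, List.prod_cons, List.sum_cons, map_mul]
        exact SuperSym.mul_mem_homogeneous _ _ (hθ i) ih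
    have hle : SuperSym.homogeneous 𝕜 (Coord.par π) Coord.wt g ≤
        (SuperSym.homogeneous 𝕜 (Coord.par π'') Coord.wt g).comap θ.toLinearMap := by
      refine Submodule.span_le.2 ?_
      rintro _ ⟨l, rfl, rfl⟩
      exact hl l
    exact fun y => hle (hs ⟨u, y.2⟩)
  isLocal W s hs x hx := by
    rintro ⟨V, i, hV, g, -, hg⟩
    exact isUnitNear_of_constHom hd u θ s hs hx hV i g hg

end ConstHom

/-! ### Sections in a chart -/

section Charts

variable {𝕜 : Type} [RCLike 𝕜] {G : Type} [AddCommGroup G]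
  {π : G → ZMod 2} {d : G → ℕ} {U : Opens (Fin (d 0) → 𝕜)} {X : GradedSpace 𝕜 G}

/-- The image of an open subset under a chart. -/
def IsChart.image {c : GradedHom (gradedDomain π d U) X} (hc : IsChart c)
    (V : Opens (gradedDomain π d U).space) : Opens X.space :=
  hc.isOpenImmersion.base_open.functor.obj V

theorem IsChart.mem_image {c : GradedHom (gradedDomain π d U) X} (hc : IsChart c)
    {V : Opens (gradedDomain π d U).space} {u : (gradedDomain π d U).space} (hu : u ∈ V) :
    c.hom.hom.base u ∈ hc.image V := ⟨u, hu, rfl⟩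

theorem IsChart.pull_bijective {c : GradedHom (gradedDomain π d U) X} (hc : IsChart c)
    (V : Opens (gradedDomain π d U).space) :
    Function.Bijective (GradedSpace.pull c.hom (hc.image V)) := by
  have : IsIso (c.hom.hom.c.app (op (hc.image V))) := hc.isOpenImmersion.c_iso V
  exact ConcreteCategory.bijective_of_isIso (c.hom.hom.c.app (op (hc.image V)))

theorem IsChart.preimage_image {c : GradedHom (gradedDomain π d U) X} (hc : IsChart c)
    (V : Opens (gradedDomain π d U).space) :
    (Opens.map c.hom.hom.base).obj (hc.image V) = V := by
  ext u
  constructor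
  · rintro ⟨v, hv, h⟩
    rwa [← hc.isOpenImmersion.base_open.injective h]
  · exact fun hu => hc.mem_image hu

/-- Let `ψ` be an algebra homomorphism from the sections of `X` near a point of a chart to a ring,
which maps sections of weight `0` to scalars and kills the coordinates of non-zero weight. Then
its values are scalars. -/
theorem IsChart.exists_eq_algebraMap {c : GradedHom (gradedDomain π d U) X} (hc : IsChart c)
    {A : Type} [Ring A] [Algebra 𝕜 A] (v : (gradedDomain π d U).space)
    (ψ : ∀ W : Opens X.space, c.hom.hom.base v ∈ W → (X.space.presheaf.obj (op W) →ₐ[𝕜] A))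
    (hψ : ∀ (V W : Opens X.space) (i : V ⟶ W) (hV : c.hom.hom.base v ∈ V) (s),
      ψ V hV ((X.space.presheaf.map i.op).hom s) = ψ W (i.le hV) s)
    (h0 : ∀ W hW, ∀ s ∈ X.weight W 0, ∃ r, ψ W hW s = algebraMap 𝕜 A r)
    (h1 : ∀ i : Coord d, ∀ W hW, ∀ s ∈ X.weight W i.wt, ψ W hW s = 0)
    (W : Opens X.space) (hW : c.hom.hom.base v ∈ W) (s : X.space.presheaf.obj (op W)) :
    ∃ r, ψ W hW s = algebraMap 𝕜 A r := by
  obtain ⟨O, hvO, J, _, f, a, hf, e⟩ :=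
    (GradedSpace.pull c.hom W s : sections π d U ((Opens.map c.hom.hom.base).obj W)).2 ⟨v, hW⟩
  -- a neighbourhood of `v` on which `s` is a finite sum of functions times fibre elements
  let V : Opens (gradedDomain π d U).space := (Opens.map c.hom.hom.base).obj W ⊓
    ⟨Subtype.val ⁻¹' (O : Set _), O.2.preimage continuous_subtype_val⟩
  have hvV : v ∈ V := ⟨hW, hvO⟩
  have hVW : hc.image V ≤ W := by
    rintro _ ⟨u, hu, rfl⟩
    exact hu.1
  have hVO : ∀ y ∈ (Opens.map c.hom.hom.base).obj (hc.image V), y.1 ∈ O := by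
    intro y hy
    rw [hc.preimage_image] at hy
    exact hy.2
  have hrange : (hc.image V : Set X.space) ⊆ Set.range c.hom.hom.base := by
    rintro _ ⟨u, -, rfl⟩
    exact ⟨u, rfl⟩
  have hv := hc.mem_image hvV
  -- the chart identifies sections over `V` with sections of `X`, compatibly with weights
  let e₀ := AlgEquiv.ofBijective _ (hc.pull_bijective V)
  let Ψ := (ψ _ hv).comp e₀.symm.toAlgHom
  have hΨ0 : ∀ t ∈ (gradedDomain π d U).weight _ 0, ∃ r, Ψ t = algebraMap 𝕜 A r := fun t ht =>
    h0 _ hv _ (hc.weight_of_pull _ hrange _ _ (by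
      have : GradedSpace.pull c.hom (hc.image V) (e₀.symm t) = t := e₀.apply_symm_apply t
      exact this.symm ▸ ht))
  have hΨ1 : ∀ i : Coord d, ∀ t ∈ (gradedDomain π d U).weight _ i.wt, Ψ t = 0 := fun i t ht =>
    h1 i _ hv _ (hc.weight_of_pull _ hrange _ _ (by
      have : GradedSpace.pull c.hom (hc.image V) (e₀.symm t) = t := e₀.apply_symm_apply t
      exact this.symm ▸ ht))
  let F : J → (gradedDomain π d U).space.presheaf.obj
      (op ((Opens.map c.hom.hom.base).obj (hc.image V))) := fun j =>
    ⟨fun y => algebraMap 𝕜 _ (f j y.1.1), fun x => ⟨O, hVO _ x.2, Unit, inferInstance, fun _ => f j,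
      fun _ => 1, fun _ => hf j, fun y _ => by simp [Algebra.algebraMap_eq_smul_one]⟩⟩
  have hF : ∀ j, F j ∈ (gradedDomain π d U).weight _ 0 := fun j y => by
    change algebraMap 𝕜 _ (f j y.1.1) ∈ _
    rw [Algebra.algebraMap_eq_smul_one]
    exact Submodule.smul_mem _ _ (SuperSym.one_mem_homogeneous _ _)
  have hsum : GradedSpace.pull c.hom (hc.image V) ((X.space.presheaf.map (homOfLE hVW).op).hom s) =
      ∑ j, F j * constSection _ (a j) := by
    rw [pull_res]
    refine Subtype.ext (funext fun y => ?_)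
    have hy : y.1 ∈ V := (hc.preimage_image V).le y.2
    refine (e ⟨y.1, hy.1⟩ hy.2).trans (Eq.trans ?_ (map_sum (evalSection y.1 y.2) _ _).symm)
    refine Finset.sum_congr rfl fun j _ => ?_
    rw [map_mul]
    exact Algebra.smul_def _ _
  have hs : ψ W hW s = Ψ (∑ j, F j * constSection _ (a j)) := by
    rw [← hsum, ← hψ _ _ (homOfLE hVW) hv]
    exact congrArg (ψ _ hv) (e₀.symm_apply_apply _).symm
  -- on the coefficient functions `Ψ` is scalar, and on fibre elements it is the augmentation
  choose r hr using fun j => hΨ0 _ (hF j)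
  have hconst : ∀ b, Ψ (constSection _ b) = algebraMap 𝕜 A (SuperSym.aug b) :=
    SuperSym.algHom_eq_algebraMap_aug (Ψ.comp (constSection _)) fun i =>
      hΨ1 i _ (constSection_mem_weight _ (SuperSym.gen_mem_homogeneous i))
  refine ⟨∑ j, r j * SuperSym.aug (a j), ?_⟩
  rw [hs, map_sum, map_sum]
  refine Finset.sum_congr rfl fun j _ => ?_
  rw [map_mul, hr, hconst, map_mul]

end Charts

/-! ### The test bundle -/

section TestBundle

variable {n : ℕ}

/-- The dimensions of the test bundle: its base is a point, and there are two coordinates for each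
multiplicity-free weight whose component at `i₀` is `1`. -/
def testDim (i₀ : Fin n) (δ : Fin n → ℤ) : ℕ :=
  open Classical in if δ ∈ multFree n ∧ δ i₀ = 1 then 2 else 0

theorem testDim_ne_zero {i₀ : Fin n} {δ : Fin n → ℤ} (h : testDim i₀ δ ≠ 0) :
    δ ∈ multFree n ∧ δ i₀ = 1 := by
  by_contra h'
  exact h (if_neg h')

theorem wt_testDim (i₀ : Fin n) (i : Coord (testDim i₀)) : i.wt i₀ = 1 := by
  refine (testDim_ne_zero ?_).2
  intro h
  have h2 : (i.2 : ℕ) < testDim i₀ i.wt := i.2.2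
  omega

/-- The `m`-th coordinate of weight `δ` of the test bundle. -/
def testCoord (i₀ : Fin n) (δ : Fin n → ℤ) (h : δ ∈ multFree n) (h' : δ i₀ = 1) (m : Fin 2) :
    Coord (testDim i₀) :=
  ⟨⟨δ, fun h0 => by simp [h0] at h'⟩, m.cast (if_pos ⟨h, h'⟩).symm⟩

end TestBundle

/-! ### Non-existence of coverings -/

section Covering

theorem parMulti_eq_totalDegree (ε : ZMod 2) {n : ℕ} (δ : Fin n → ℤ) :
    parMulti ε δ = parZ ε (totalDegree n δ) := by
  simp [parMulti, parZ, totalDegree, Finset.sum_mul]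

/-- Every weight `k` between `2` and `n` is the sum of the total degrees of two multiplicity-free
weights which overlap. -/
theorem exists_multFree_totalDegree_add {n : ℕ} {k : ℤ} (hk : 2 ≤ k) (hkn : k ≤ n) :
    ∃ (i₀ : Fin n) (v w : Fin n → ℤ), v ∈ multFree n ∧ v i₀ = 1 ∧ w ∈ multFree n ∧ w i₀ = 1 ∧
      totalDegree n (v + w) = k := by
  obtain ⟨m, rfl⟩ : ∃ m : ℕ, k = m + 1 := ⟨(k - 1).toNat, by omega⟩
  refine ⟨⟨0, by omega⟩, Pi.single ⟨0, by omega⟩ 1, fun i => if (i : ℕ) < m then 1 else 0,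
    fun i => ?_, Pi.single_eq_same _ _, fun i => ?_, if_pos (by change 0 < m; omega), ?_⟩
  · by_cases h : i = ⟨0, by omega⟩
    · exact Or.inr (by rw [h, Pi.single_eq_same])
    · exact Or.inl (Pi.single_eq_of_ne h _)
  · by_cases h : (i : ℕ) < m
    · exact Or.inr (if_pos h)
    · exact Or.inl (if_neg h)
  · rw [map_add, add_comm]
    congr 1
    · change ∑ i : Fin n, (if (i : ℕ) < m then (1 : ℤ) else 0) = m
      rw [Finset.sum_boole, Fin.card_filter_val_lt]
      have : min n m = m := by omega
      simp [this]
    · exact Fintype.sum_pi_single' (⟨0, by omega⟩ : Fin n) (1 : ℤ)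

variable {𝕜 : Type} [RCLike 𝕜]

/-- The test bundle: the graded domain with the dimensions `testDim` over the point. -/
abbrev testBundle (𝕜 : Type) [RCLike 𝕜] (ε : ZMod 2) {n : ℕ} (i₀ : Fin n) :
    GradedSpace 𝕜 (Fin n → ℤ) :=
  gradedDomain (parMulti ε) (testDim i₀) ⊤

theorem isNFoldVectorBundle_testBundle (ε : ZMod 2) {n : ℕ} (i₀ : Fin n) :
    IsNFoldVectorBundle ε n (testBundle 𝕜 ε i₀) :=
  ⟨testDim i₀, fun _ h => (testDim_ne_zero h).1, isGradedManifold_gradedDomain _ _ _⟩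

theorem not_exists_isCovering (ε : ZMod 2) (n : ℕ) (d : ℤ → ℕ) (N : GradedSpace 𝕜 ℤ)
    (hN : IsGradedManifoldOfDegree ε n d N) (hne : Nonempty N.space)
    (hk : ∃ k : ℤ, 2 ≤ k ∧ d k ≠ 0) :
    ¬ ∃ (Q : GradedSpace 𝕜 (Fin n → ℤ)) (q : GradedHom Q.total N), IsCovering ε Q q := by
  rintro ⟨Q, q, ⟨dQ, hdQ, hQ⟩, hcov⟩
  obtain ⟨k, hk2, hdk⟩ := hk
  obtain ⟨i₀, w₁, w₂, hw₁, hw₁', hw₂, hw₂', hsum⟩ :=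
    exists_multFree_totalDegree_add hk2 (hN.1 hdk).2
  obtain ⟨U, c, hc, u, -⟩ := hN.2.charts hne.some
  let e₁ := testCoord i₀ w₁ hw₁ hw₁' 0
  let e₂ := testCoord i₀ w₂ hw₂ hw₂' 1
  have he : e₁ ≠ e₂ := fun h => 
    absurd (congrArg (fun i : Coord (testDim i₀) => (i.2 : ℕ)) h) Nat.zero_ne_one
  let ξ : Coord d := ⟨⟨k, by omega⟩, ⟨0, Nat.pos_of_ne_zero hdk⟩⟩
  have hξ : Coord.par (parZ ε) ξ = Coord.par (parMulti ε) e₁ + Coord.par (parMulti ε) e₂ := by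
    change parZ ε k = parMulti ε w₁ + parMulti ε w₂
    rw [parMulti_eq_totalDegree, parMulti_eq_totalDegree, ← hsum, map_add]
    simp [parZ, add_mul]
  have : Nontrivial (FibreAlg 𝕜 (parMulti ε) (testDim i₀)) :=
    nontrivial_of_ne _ _ (SuperSym.gen_mul_gen_ne_zero he)
  -- in both fibre algebras, the scalars are the only elements of weight `0`
  have hd : ∀ l : List (Coord d), (l.map Coord.wt).sum = 0 → l = [] := by
    refine SuperSym.eq_nil_of_map_sum_eq_zero (AddMonoidHom.id ℤ) fun i => ?_
    have h1 : d i.wt ≠ 0 := by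
      have := i.2.2
      change (i.2 : ℕ) < d i.wt at this
      omega
    exact lt_of_le_of_ne (hN.1 h1).1 (Ne.symm i.1.2)
  let χ : (Fin n → ℤ) →+ ℤ := Pi.evalAddMonoidHom _ i₀
  have hχ : ∀ i : Coord (testDim i₀), χ i.wt = 1 := wt_testDim i₀
  have hχ' : ∀ i : Coord (testDim i₀), 0 < χ i.wt := fun i => by rw [hχ]; exact one_pos
  have hd' : ∀ l : List (Coord (testDim i₀)), (l.map Coord.wt).sum = 0 → l = [] := fun l hl =>
    SuperSym.eq_nil_of_map_sum_eq_zero χ hχ' l (by rw [hl, map_zero])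
  let θ : FibreAlg 𝕜 (parZ ε) d →ₐ[𝕜] FibreAlg 𝕜 (parMulti ε) (testDim i₀) :=
    SuperSym.liftMul ξ e₁ e₂ hξ
  let φ : GradedHom (testBundle 𝕜 ε i₀).total N :=
    (constGradedHomCollapse (totalDegree n) hd u θ fun W i => by
      by_cases hi : i = ξ
      · subst hi
        rw [SuperSym.liftMul_gen_self]
        exact Submodule.mem_iSup_of_mem ⟨w₁ + w₂, hsum⟩ (constSection_mem_weight W
          (SuperSym.mul_mem_homogeneous _ _ (SuperSym.gen_mem_homogeneous e₁)
            (SuperSym.gen_mem_homogeneous e₂)))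
      · rw [SuperSym.liftMul_gen_of_ne _ hi, map_zero]
        exact zero_mem _).comp c
  -- a rescaling of the coordinates that fixes the product of `e₁` and `e₂`, but none of them
  let r : Coord (testDim i₀) → 𝕜 := open Classical in fun i => if i = e₂ then 2⁻¹ else 2
  let pt : (testBundle 𝕜 ε i₀).space := (⟨0, trivial⟩ : (⊤ : Opens (Fin (testDim i₀ 0) → 𝕜)))
  let σ : GradedHom (testBundle 𝕜 ε i₀) (testBundle 𝕜 ε i₀) :=
    constGradedHom hd' pt (SuperSym.scale r) fun i => by
      rw [SuperSym.scale_gen]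
      exact Submodule.smul_mem _ _ (SuperSym.gen_mem_homogeneous i)
  have hσθ : (SuperSym.scale r).comp θ = θ := by
    refine SuperSym.algHom_ext fun i => ?_
    by_cases hi : i = ξ
    · subst hi
      simp [θ, SuperSym.liftMul_gen_self, r, he, smul_smul]
    · simp [θ, SuperSym.liftMul_gen_of_ne _ hi]
  have hσφ : σ.hom ≫ φ.hom = φ.hom := by
    exact congrArg (· ≫ c.hom)
      ((constHom_comp u pt θ (SuperSym.scale r)).trans (congrArg (constHom u) hσθ))
  -- uniqueness of the factorization makes `Φ` invariant under the rescaling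
  obtain ⟨Φ, hΦ, huniq⟩ := hcov _ (isNFoldVectorBundle_testBundle ε i₀) φ
  have hσΦ : σ.comp Φ = Φ := huniq _ (by
    change σ.hom ≫ (Φ.hom ≫ q.hom) = φ.hom
    rw [hΦ]
    exact hσφ)
  obtain ⟨UQ, cQ, hcQ, v, hv⟩ := hQ.charts (Φ.hom.hom.base pt)
  have hpt : ∀ W : Opens Q.space, cQ.hom.hom.base v ∈ W → Φ.hom.hom.base pt ∈ W := fun W hW =>
    hv ▸ hW
  -- the value at the base point of the pull-back along `Φ`
  let ψ : ∀ W : Opens Q.space, cQ.hom.hom.base v ∈ W →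
      (Q.space.presheaf.obj (op W) →ₐ[𝕜] FibreAlg 𝕜 (parMulti ε) (testDim i₀)) := fun W hW =>
    (evalSection pt (hpt W hW)).comp (GradedSpace.pull Φ.hom W)
  have hscalar := hcQ.exists_eq_algebraMap v ψ
    (fun V W i hV s => congrArg (evalSection pt _) (pull_res Φ.hom i s))
    (fun W hW s hs => ⟨_, SuperSym.eq_algebraMap_of_mem_homogeneous_zero hd'
      (Φ.map_weight W 0 s hs ⟨pt, hpt W hW⟩)⟩)
    (by
      intro i W hW s hs
      have hmem := Φ.map_weight W i.wt s hs ⟨pt, hpt W hW⟩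
      have hwt : i.wt ∈ multFree n := hdQ (by
        have := i.2.2
        change (i.2 : ℕ) < dQ i.wt at this
        change dQ i.wt ≠ 0
        omega)
      rcases hwt i₀ with h0 | h1
      · exact SuperSym.eq_zero_of_mem_homogeneous χ hχ' h0 i.1.2 hmem
      · have hfix : ∀ Ψ : GradedHom (testBundle 𝕜 ε i₀) Q, Ψ = Φ →
            ∀ h : Ψ.hom.hom.base pt ∈ W,
              evalSection pt h (GradedSpace.pull Ψ.hom W s) = ψ W hW s := by
          rintro _ rfl _
          rfl
        refine SuperSym.eq_zero_of_scale_eq (r := r) (b := 2⁻¹) (c := 2) χ hχ (by norm_num)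
          (by norm_num) (fun j => ?_) h1 hmem (hfix _ hσΦ (hpt W hW))
        by_cases hj : j = e₂
        · exact Or.inl (if_pos hj)
        · exact Or.inr (if_neg hj))
  -- a section of `N` near the base point that restricts to the coordinate `ξ` in the chart
  obtain ⟨t, ht⟩ := (hc.pull_bijective ⊤).2 (constSection _ (SuperSym.gen 𝕜 _ ξ))
  have hmem : φ.hom.hom.base pt ∈ hc.image ⊤ := hc.mem_image (u := u) trivial
  have hmem' : (Φ.hom ≫ q.hom).hom.base pt ∈ hc.image ⊤ := by
    rw [hΦ]
    exact hmem
  have hval : ∀ f : (testBundle 𝕜 ε i₀).space ⟶ N.space, f = φ.hom →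
      ∀ h : f.hom.base pt ∈ hc.image ⊤, evalSection pt h (GradedSpace.pull f (hc.image ⊤) t) =
        SuperSym.gen 𝕜 _ e₁ * SuperSym.gen 𝕜 _ e₂ := by
    rintro _ rfl h
    change θ (evalSection u h (GradedSpace.pull c.hom (hc.image ⊤) t)) = _
    rw [ht]
    exact SuperSym.liftMul_gen_self hξ
  obtain ⟨a, ha⟩ := hscalar ((Opens.map q.hom.hom.base).obj (hc.image ⊤)) (hv ▸ hmem')
    (GradedSpace.pull q.hom (hc.image ⊤) t)
  exact SuperSym.gen_mul_gen_ne_algebraMap he a ((hval _ hΦ hmem').symm.trans ha)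

end Covering

end GradedGeometry

end

theorem mainTheorem6 {𝕜 : Type} [RCLike 𝕜] (ε : ZMod 2) :
    (∀ (n : ℕ) (d : ℤ → ℕ) (N : GradedSpace 𝕜 ℤ), IsGradedManifoldOfDegree ε n d N →
      Nonempty N.space → (∃ k : ℤ, 2 ≤ k ∧ d k ≠ 0) →
      ¬ ∃ (Q : GradedSpace 𝕜 (Fin n → ℤ)) (q : GradedHom Q.total N), IsCovering ε Q q) ∧
    (∀ U : Opens (Fin (dimXi 0) → 𝕜), (U : Set (Fin (dimXi 0) → 𝕜)).Nonempty →
      ¬ ∃ (Q : GradedSpace 𝕜 (Fin 2 → ℤ))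
        (q : GradedHom Q.total (gradedDomain (parZ ε) dimXi U)), IsCovering ε Q q) := by
  refine ⟨not_exists_isCovering ε, fun U hU => ?_⟩
  refine not_exists_isCovering ε 2 dimXi _ ⟨fun k hk => ?_, isGradedManifold_gradedDomain _ _ _⟩
    hU.to_subtype ⟨2, le_rfl, by simp [dimXi]⟩
  have : k = 0 ∨ k = 1 ∨ k = 2 := by
    by_contra h
    exact hk (if_neg h)
  rcases this with rfl | rfl | rfl <;> simp
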